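/- All rings are commutative with identity. For a ring $R$ and a positive integer $n$, a proper ideal $I$ of $R$ is called $n$-absorbing if whenever $r_1\cdots r_{n+1}\in I$ with $r_1,\dots,r_{n+1}\in R$, there are $n$ of the $r_i$'s whose product is in $I$. Let $\omega_R(I)$ be the least positive integer $n$ such that $I$ is $n$-absorbing, and $\omega_R(I)=\infty$ if there is no such $n$. Let $I[X]\subseteq R[X]$ and $I[[X]]\subseteq R[[X]]$ denote the ideals of all polynomials, respectively power series, whose coefficients all lie in $I$. Let $D$ be either a Prüfer domain (an integral domain in which every nonzero finitely generated ideal is invertible) or a torsion-free valuation ring (a ring, not necessarily a domain, in which of any two elements one divides the other, and whose additive group is torsion-free). Let $I$ be a radical ideal of $D$. Then \[\omega_{D[[X]]}(I[[X]])=\omega_{D[X]}(I[X])=\omega_D(I).\] -/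

import Mathlib

/-- A proper ideal `I` is `n`-absorbing if, whenever a product of `n + 1` elements lies in `I`,
there are `n` of these elements (i.e. `n` of the indices) whose product lies in `I`. -/
structure IsNAbsorbing {R : Type*} [CommRing R] (n : ℕ) (I : Ideal R) : Prop where
  ne_top : I ≠ ⊤
  absorbing : ∀ r : Fin (n + 1) → R, ∏ i, r i ∈ I →
    ∃ s : Finset (Fin (n + 1)), s.card = n ∧ ∏ i ∈ s, r i ∈ I

/-- `ω_R(I)`: the least positive integer `n` such that `I` is `n`-absorbing, and `∞` if there is
none (the infimum of the empty set in `ℕ∞` is `⊤`). -/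
noncomputable def absorbingOmega {R : Type*} [CommRing R] (I : Ideal R) : ℕ∞ :=
  sInf {m : ℕ∞ | ∃ n : ℕ, 0 < n ∧ IsNAbsorbing n I ∧ m = (n : ℕ∞)}

/-- `I[X]`: the ideal of `R[X]` of all polynomials whose coefficients all lie in `I`. -/
def polynomialIdeal {R : Type*} [CommRing R] (I : Ideal R) : Ideal (Polynomial R) where
  carrier := {f | ∀ n : ℕ, f.coeff n ∈ I}
  zero_mem' := fun n => by simp
  add_mem' := fun {f g} hf hg n => by
    rw [Polynomial.coeff_add]
    exact I.add_mem (hf n) (hg n)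
  smul_mem' := fun c f hf n => by
    rw [smul_eq_mul, Polynomial.coeff_mul]
    exact I.sum_mem fun p _ => I.mul_mem_left _ (hf p.2)

/-- `I[[X]]`: the ideal of `R[[X]]` of all power series whose coefficients all lie in `I`. -/
def powerSeriesIdeal {R : Type*} [CommRing R] (I : Ideal R) : Ideal (PowerSeries R) where
  carrier := {f | ∀ n : ℕ, PowerSeries.coeff n f ∈ I}
  zero_mem' := fun n => by simp
  add_mem' := fun {f g} hf hg n => by
    rw [map_add]
    exact I.add_mem (hf n) (hg n)
  smul_mem' := fun c f hf n => by
    rw [smul_eq_mul, PowerSeries.coeff_mul]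
    exact I.sum_mem fun p _ => I.mul_mem_left _ (hf p.2)

/-- A Prüfer domain: an integral domain in which every nonzero finitely generated ideal is
invertible (as a fractional ideal). -/
structure IsPruferDomain (D : Type*) [CommRing D] : Prop where
  isDomain : IsDomain D
  isUnit_of_fg : ∀ I : Ideal D, I ≠ ⊥ → I.FG →
    IsUnit (I : FractionalIdeal (nonZeroDivisors D) (FractionRing D))

/-- A valuation ring whose additive group is torsion-free. `PreValuationRing` says that of any two
elements one divides the other; the ring is not required to be a domain. -/
structure IsTorsionFreeValuationRing (D : Type*) [CommRing D] : Prop where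
  preValuationRing : PreValuationRing D
  isAddTorsionFree : IsAddTorsionFree D

/-! A radical ideal is the intersection of its minimal primes, so being `n`-absorbing amounts to
counting them. At most `n` primes suffice for absorption: keep one factor for each prime.
Conversely, `n + 1` minimal primes yield `n + 1` elements with product in `I` but no `n`-fold
subproduct in `I` (`IsNAbsorbing.not_injective_minimalPrimes`). Coefficientwise extension preserves
intersections and primes, since `P[X]` and `P[[X]]` are kernels of reduction to a domain. Hence
absorption passes up from `I`; it passes down by contraction to constants. -/

/-- If `I` is radical and `P` is a minimal prime of `I`, every element of `P` is killed modulo `I`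
by an element outside `P`. -/
theorem Ideal.IsRadical.exists_notMem_mul_mem {R : Type*} [CommRing R] {I P : Ideal R}
    (hI : I.IsRadical) (hP : P ∈ I.minimalPrimes) {x : R} (hx : x ∈ P) :
    ∃ c ∉ P, c * x ∈ I := by
  have hPp : P.IsPrime := hP.1.1
  by_contra! h
  -- A prime over `I` avoiding this monoid would lie in `P` and omit `x`, against minimality.
  have hdisj : Disjoint (I : Set R) (P.primeCompl ⊔ Submonoid.powers x : Submonoid R) := by
    rw [Set.disjoint_left]
    intro y hyI hy
    obtain ⟨s, hs, _, ⟨k, rfl⟩, rfl⟩ := Submonoid.mem_sup.1 hy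
    refine h s hs (hI ⟨k + 1, ?_⟩)
    have : (s * x) ^ (k + 1) = s ^ k * x * (s * x ^ k) := by ring
    rw [this]
    exact I.mul_mem_left _ hyI
  obtain ⟨Q, hQ, hIQ, hdisjQ⟩ := Ideal.exists_le_prime_disjoint I _ hdisj
  rw [Set.disjoint_left] at hdisjQ
  have hQP : Q ≤ P := fun y hy => by
    by_contra hyP
    exact hdisjQ hy (Submonoid.mem_sup_left (show y ∈ P.primeCompl from hyP))
  exact hdisjQ (hP.2 ⟨hQ, hIQ⟩ hQP hx) (Submonoid.mem_sup_right (Submonoid.mem_powers x))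

/-- A radical `n`-absorbing ideal does not have `n + 1` distinct minimal primes. -/
theorem IsNAbsorbing.not_injective_minimalPrimes {R : Type*} [CommRing R] {n : ℕ} {I : Ideal R}
    (h : IsNAbsorbing n I) (hI : I.IsRadical) (P : Fin (n + 1) → Ideal R)
    (hP : ∀ i, P i ∈ I.minimalPrimes) : ¬ Function.Injective P := by
  intro hinj
  have hprime (i) : (P i).IsPrime := (hP i).1.1
  have hle (i) : I ≤ P i := (hP i).1.2
  -- Prime avoidance: otherwise `P i` lies in another `P j`, hence equals it by minimality.
  have hx (i) : ∃ x ∈ P i, ∀ j, j ≠ i → x ∉ P j := by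
    by_contra! hcon
    have hsub : (P i : Set R) ⊆ ⋃ j ∈ (↑(Finset.univ.erase i) : Set (Fin (n + 1))), P j := by
      intro x hx
      obtain ⟨j, hji, hxj⟩ := hcon x hx
      exact Set.mem_biUnion (by simpa using hji) hxj
    obtain ⟨j, hj, hij⟩ := (Ideal.subset_union_prime i i fun j _ _ _ => hprime j).1 hsub
    exact (Finset.mem_erase.1 hj).1 (hinj (le_antisymm ((hP j).2 (hP i).1 hij) hij))
  choose x hxP hxnot using hx
  choose c hcP hcx using fun i => hI.exists_notMem_mul_mem (hP i) (hxP i)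
  have hc {i j} (hij : j ≠ i) : c i ∈ P j :=
    ((hprime j).mem_or_mem (hle j (hcx i))).resolve_right (hxnot i j hij)
  -- Each summand `c i` sends its own `x i` into `I`, so the product is in `I`. For `j ≠ 0`, `c j`
  -- is the only summand outside `P j`, so the sum avoids `P j`.
  let r : Fin (n + 1) → R := Fin.cons (∑ i : Fin n, c i.succ) fun i => x i.succ
  have hr0 : r 0 = ∑ i : Fin n, c i.succ := rfl
  have hrs (i : Fin n) : r i.succ = x i.succ := rfl
  have hprod : ∏ i, r i ∈ I := by
    rw [Fin.prod_univ_succ, hr0, Finset.sum_mul]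
    refine I.sum_mem fun i _ => ?_
    rw [← Finset.mul_prod_erase _ _ (Finset.mem_univ i), hrs, ← mul_assoc]
    exact I.mul_mem_right _ (hcx _)
  have hnot : ∀ i j, i ≠ j → r i ∉ P j := by
    intro i j hij
    cases i using Fin.cases with
    | succ i => exact hxnot _ _ hij.symm
    | zero =>
      cases j using Fin.cases with
      | zero => exact absurd rfl hij
      | succ j =>
        intro hmem
        rw [hr0, ← Finset.add_sum_erase _ _ (Finset.mem_univ j)] at hmem
        refine hcP _ (((P j.succ).add_mem_iff_left (Ideal.sum_mem _ fun k hk => hc ?_)).1 hmem)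
        exact fun hjk => (Finset.mem_erase.1 hk).1 (Fin.succ_injective _ hjk).symm
  obtain ⟨s, hs, hsI⟩ := h.absorbing r hprod
  -- All factors other than `r j` avoid the prime `P j`, so their product does too.
  obtain ⟨j, hj⟩ : ∃ j, j ∉ s := by
    by_contra! hall
    have := Finset.eq_univ_iff_forall.2 hall
    simp [this] at hs
  obtain ⟨i, his, hi⟩ := ((hprime j).prod_mem_iff).1 (hle j hsI)
  exact hnot i j (fun hij => hj (hij ▸ his)) hi

theorem IsNAbsorbing.encard_minimalPrimes_le {R : Type*} [CommRing R] {n : ℕ} {I : Ideal R}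
    (h : IsNAbsorbing n I) (hI : I.IsRadical) : I.minimalPrimes.encard ≤ n := by
  by_contra! hlt
  obtain ⟨t, htI, htn⟩ := Set.exists_subset_encard_eq (Order.add_one_le_of_lt hlt)
  have hfin : t.Finite := Set.finite_of_encard_eq_coe (k := n + 1) (by simpa using htn)
  have hcard : Nat.card t = n + 1 := by
    rw [Nat.card_coe_set_eq, Set.ncard, htn]
    rfl
  have : Finite t := hfin
  let e := (Finite.equivFinOfCardEq hcard).symm
  exact h.not_injective_minimalPrimes hI (fun i => (e i : Ideal R)) (fun i => htI (e i).2)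
    (Subtype.val_injective.comp e.injective)

/-- A proper ideal that is an intersection of at most `n` primes is `n`-absorbing. -/
theorem isNAbsorbing_of_mem_iff_forall_mem_isPrime {R ι : Type*} [CommRing R] [Finite ι] {n : ℕ}
    {I : Ideal R} (hI : I ≠ ⊤) (P : ι → Ideal R) (hP : ∀ k, (P k).IsPrime)
    (hmem : ∀ x, x ∈ I ↔ ∀ k, x ∈ P k) (hn : Nat.card ι ≤ n) : IsNAbsorbing n I := by
  classical
  have := Fintype.ofFinite ι
  refine ⟨hI, fun r hr => ?_⟩
  have hex (k) : ∃ i, r i ∈ P k := by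
    obtain ⟨i, -, hi⟩ := ((hP k).prod_mem_iff).1 ((hmem _).1 hr k)
    exact ⟨i, hi⟩
  choose f hf using hex
  have hle : (Finset.univ.image f).card ≤ n :=
    Finset.card_image_le.trans (by rwa [Finset.card_univ, ← Nat.card_eq_fintype_card])
  obtain ⟨s, hfs, -, hs⟩ := Finset.exists_subsuperset_card_eq
    (Finset.subset_univ (Finset.univ.image f)) hle (by simp)
  refine ⟨s, hs, (hmem _).2 fun k => ?_⟩
  exact Ideal.mem_of_dvd _ (Finset.dvd_prod_of_mem r
    (hfs (Finset.mem_image_of_mem f (Finset.mem_univ k)))) (hf k)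

theorem mem_polynomialIdeal {R : Type*} [CommRing R] {I : Ideal R} {f : Polynomial R} :
    f ∈ polynomialIdeal I ↔ ∀ n, f.coeff n ∈ I := Iff.rfl

theorem mem_powerSeriesIdeal {R : Type*} [CommRing R] {I : Ideal R} {f : PowerSeries R} :
    f ∈ powerSeriesIdeal I ↔ ∀ n, PowerSeries.coeff n f ∈ I := Iff.rfl

theorem polynomialIdeal_isPrime {R : Type*} [CommRing R] {P : Ideal R} (hP : P.IsPrime) :
    (polynomialIdeal P).IsPrime := by
  have : polynomialIdeal P = RingHom.ker (Polynomial.mapRingHom (Ideal.Quotient.mk P)) := by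
    ext f
    simp [mem_polynomialIdeal, RingHom.mem_ker, Polynomial.ext_iff, Ideal.Quotient.eq_zero_iff_mem]
  rw [this]
  exact RingHom.ker_isPrime _

theorem powerSeriesIdeal_isPrime {R : Type*} [CommRing R] {P : Ideal R} (hP : P.IsPrime) :
    (powerSeriesIdeal P).IsPrime := by
  have : powerSeriesIdeal P = RingHom.ker (PowerSeries.map (Ideal.Quotient.mk P)) := by
    ext f
    simp [mem_powerSeriesIdeal, RingHom.mem_ker, PowerSeries.ext_iff,
      Ideal.Quotient.eq_zero_iff_mem]
  rw [this]
  exact RingHom.ker_isPrime _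

theorem comap_C_polynomialIdeal {R : Type*} [CommRing R] (I : Ideal R) :
    (polynomialIdeal I).comap Polynomial.C = I := by
  ext x
  rw [Ideal.mem_comap, mem_polynomialIdeal]
  refine ⟨fun h => by simpa using h 0, fun h n => ?_⟩
  rw [Polynomial.coeff_C]
  split_ifs
  exacts [h, I.zero_mem]

theorem comap_C_powerSeriesIdeal {R : Type*} [CommRing R] (I : Ideal R) :
    (powerSeriesIdeal I).comap PowerSeries.C = I := by
  ext x
  rw [Ideal.mem_comap, mem_powerSeriesIdeal]
  refine ⟨fun h => by simpa using h 0, fun h n => ?_⟩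
  rw [PowerSeries.coeff_C]
  split_ifs
  exacts [h, I.zero_mem]

theorem IsNAbsorbing.comap {R S : Type*} [CommRing R] [CommRing S] {n : ℕ} {J : Ideal S}
    (h : IsNAbsorbing n J) (f : R →+* S) : IsNAbsorbing n (J.comap f) where
  ne_top := Ideal.comap_ne_top f h.ne_top
  absorbing r hr := by
    simp only [Ideal.mem_comap, map_prod] at hr ⊢
    exact h.absorbing _ hr

theorem Ideal.IsRadical.mem_iff_forall_mem_minimalPrimes {R : Type*} [CommRing R] {I : Ideal R}
    (hI : I.IsRadical) (x : R) : x ∈ I ↔ ∀ P : I.minimalPrimes, x ∈ (P : Ideal R) := by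
  conv_lhs => rw [← hI.radical, ← Ideal.sInf_minimalPrimes, Ideal.mem_sInf]
  exact ⟨fun h P => h P.2, fun h P hP => h ⟨P, hP⟩⟩

/-- If the ideals `F P` are prime for the primes `P`, and `F` commutes with the presentation of the
radical `n`-absorbing ideal `I` as the intersection of its minimal primes, then `F I` is
`n`-absorbing. -/
theorem IsNAbsorbing.of_minimalPrimes {R S : Type*} [CommRing R] [CommRing S] {n : ℕ} {I : Ideal R}
    (h : IsNAbsorbing n I) (hI : I.IsRadical) (F : Ideal R → Ideal S)
    (hF : ∀ P : Ideal R, P.IsPrime → (F P).IsPrime)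
    (hmem : ∀ x, x ∈ F I ↔ ∀ P : I.minimalPrimes, x ∈ F P) : IsNAbsorbing n (F I) := by
  have hcard := h.encard_minimalPrimes_le hI
  have hfin : I.minimalPrimes.Finite := Set.finite_of_encard_le_coe hcard
  have : Finite I.minimalPrimes := hfin
  obtain ⟨P⟩ := Ideal.nonempty_minimalPrimes h.ne_top
  have hne : F I ≠ ⊤ := fun htop => (hF P P.2.1.1).ne_top <|
    (Ideal.eq_top_iff_one _).2 ((hmem 1).1 (htop ▸ Submodule.mem_top) P)
  refine isNAbsorbing_of_mem_iff_forall_mem_isPrime hne (fun P : I.minimalPrimes => F P)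
    (fun P => hF P P.2.1.1) hmem ?_
  rw [Nat.card_coe_set_eq]
  exact_mod_cast hfin.cast_ncard_eq.trans_le hcard

theorem Ideal.IsRadical.isNAbsorbing_polynomialIdeal_iff {R : Type*} [CommRing R] {I : Ideal R}
    (hI : I.IsRadical) {n : ℕ} : IsNAbsorbing n (polynomialIdeal I) ↔ IsNAbsorbing n I := by
  refine ⟨fun h => comap_C_polynomialIdeal I ▸ h.comap Polynomial.C, fun h =>
    h.of_minimalPrimes hI polynomialIdeal (fun P hP => polynomialIdeal_isPrime hP) fun f => ?_⟩
  simp only [mem_polynomialIdeal, hI.mem_iff_forall_mem_minimalPrimes]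
  exact forall_comm

theorem Ideal.IsRadical.isNAbsorbing_powerSeriesIdeal_iff {R : Type*} [CommRing R] {I : Ideal R}
    (hI : I.IsRadical) {n : ℕ} : IsNAbsorbing n (powerSeriesIdeal I) ↔ IsNAbsorbing n I := by
  refine ⟨fun h => comap_C_powerSeriesIdeal I ▸ h.comap PowerSeries.C, fun h =>
    h.of_minimalPrimes hI powerSeriesIdeal (fun P hP => powerSeriesIdeal_isPrime hP) fun f => ?_⟩
  simp only [mem_powerSeriesIdeal, hI.mem_iff_forall_mem_minimalPrimes]
  exact forall_comm

/-- The equalities hold for a radical ideal of any commutative ring: such an ideal is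
`n`-absorbing exactly when it is proper with at most `n` minimal primes, so the hypothesis on `D` is
not needed. -/
theorem mainTheorem4 {D : Type*} [CommRing D]
    (hD : IsPruferDomain D ∨ IsTorsionFreeValuationRing D)
    (I : Ideal D) (hI : I.IsRadical) :
    absorbingOmega (powerSeriesIdeal I) = absorbingOmega (polynomialIdeal I) ∧
      absorbingOmega (polynomialIdeal I) = absorbingOmega I := by
  simp only [absorbingOmega, hI.isNAbsorbing_polynomialIdeal_iff,
    hI.isNAbsorbing_powerSeriesIdeal_iff, and_self]
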